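/- Let $H\in(0,\tfrac12)\cup(\tfrac12,1)$ and $\theta>0$. Let $S^H=\{S^H_t,\ t\ge 0\}$ be a sub-fractional Brownian motion with parameter $H$, i.e. a centered Gaussian process with covariance $$E\left(S^H_tS^H_s\right)=t^{2H}+s^{2H}-\tfrac12\left((t+s)^{2H}+|t-s|^{2H}\right),\qquad s,t\ge 0,$$ and let $X=\{X_t,\ t\ge0\}$ be the Ornstein–Uhlenbeck process driven by $S^H$, i.e. the continuous solution of $X_0=0$, $dX_t=-\theta X_t\,dt+dS^H_t$; that is, almost surely, $X_t=-\theta\int_0^tX_r\,dr+S^H_t$ for all $t\ge 0$. The increments of the driving process $S^H$ are not stationary, that is, it is not the case that for every $s\ge 0$ the processes $\{S^H_{t+s}-S^H_s,\ t\ge0\}$ and $\{S^H_t-S^H_0,\ t\ge0\}$ have the same finite-dimensional distributions. Still, $E[X_t^2]<\infty$ for all $t\ge0$, and there exists a constant $C>0$ depending only on $\theta$ and $H$ such that $$\left|E\left[X_t^2\right]-\frac{H\,\Gamma(2H)}{\theta^{2H}}\right|\le C\,t^{2H-2}\qquad\text{for all } t>2,$$ and $$E\left(X_tX_s\right)\le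 C\,|t-s|^{2H-2}\qquad\text{for all } s,t\ge0 \text{ with } |t-s|>2.$$ -/

import Mathlib

open MeasureTheory ProbabilityTheory
open scoped NNReal

/-- `S = (S_t)_{t ≥ 0}` is a sub-fractional Brownian motion with parameter `H` on the probability
space `(Ω, P)`: a centered Gaussian process with covariance
`E (S_t S_s) = t^{2H} + s^{2H} - ((t + s)^{2H} + |t - s|^{2H}) / 2`. -/
structure IsSubfBm {Ω : Type*} [MeasurableSpace Ω] (P : Measure Ω) (H : ℝ)
    (S : ℝ≥0 → Ω → ℝ) : Prop where
  gaussian : IsGaussianProcess S P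
  centered : ∀ t, ∫ ω, S t ω ∂P = 0
  covariance : ∀ t s : ℝ≥0, ∫ ω, S t ω * S s ω ∂P =
    (t : ℝ) ^ (2 * H) + (s : ℝ) ^ (2 * H)
      - (1 / 2) * (((t : ℝ) + s) ^ (2 * H) + |(t : ℝ) - s| ^ (2 * H))

/-- `X` is a continuous solution of the Langevin equation `X_0 = 0`, `dX_t = -θ X_t dt + dG_t`:
almost surely the path `t ↦ X_t` is continuous and starts at `0`, and
`X_t = -θ ∫_0^t X_r dr + G_t` for all `t ≥ 0`. -/
structure IsLangevinSolution {Ω : Type*} [MeasurableSpace Ω] (P : Measure Ω) (θ : ℝ)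
    (G X : ℝ≥0 → Ω → ℝ) : Prop where
  continuous : ∀ᵐ ω ∂P, Continuous fun t => X t ω
  init : ∀ᵐ ω ∂P, X 0 ω = 0
  equation : ∀ᵐ ω ∂P, ∀ t : ℝ≥0,
    X t ω = -θ * (∫ r in (0 : ℝ)..t, X r.toNNReal ω) + G t ω

/-- `G` has stationary increments: for every `s ≥ 0`, the processes `(G_{t+s} - G_s)_{t ≥ 0}` and
`(G_t - G_0)_{t ≥ 0}` have the same finite-dimensional distributions. -/
def HasStationaryIncrements {Ω : Type*} [MeasurableSpace Ω] (P : Measure Ω)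
    (G : ℝ≥0 → Ω → ℝ) : Prop :=
  ∀ (s : ℝ≥0) (I : Finset ℝ≥0),
    IdentDistrib (fun ω (t : I) => G (t + s) ω - G s ω) (fun ω (t : I) => G t ω - G 0 ω) P P

/-! Put `a = 2 * H`. Variation of constants writes `X_t` as the linear functional `ouFilter θ t` of
the path of `S`, formally the integral of `exp (-θ (t - r)) dS_r` over `[0, t]`. By Fubini, `E (X_t
X_s)` is this filter applied in both variables to the covariance kernel of `S`, so both estimates
become statements about `subfBmCov a`.

The kernel is the fractional Brownian one plus a term depending on `|x + y| ^ a`. The first part is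
computed exactly through incomplete Laplace transforms of `z ^ a`; it yields the Gamma constant with
an exponentially small error (`abs_ouFilter_ouFilter_fBmCov_sub_le`). The other part, and the decay
of the covariance, rest on one principle (`abs_ouFilter_ouFilter_sub_le`): a rectangular increment
of `|x ± y| ^ a` at distance `D` from the singularity is of order `D ^ (a - 2)` times the area,
while everything before a cutoff time `p` is damped by `exp (-θ (t - p))`. The cutoff is `t / 2` for
the variance and `(t + s) / 2` for the covariance.

Stationarity fails already for the variances of the increments over `[0, 1]` and `[1, 2]`. -/

/-! ### The Ornstein–Uhlenbeck filter on deterministic paths -/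

/-- The value at time `t` of the solution of the Langevin equation driven by the path `h`. -/
noncomputable def ouFilter (θ t : ℝ) (h : ℝ → ℝ) : ℝ :=
  h t - θ * ∫ r in (0 : ℝ)..t, Real.exp (-θ * (t - r)) * h r

/-- The contribution to `ouFilter θ t h` of the increments of `h` on `[p, t]`. -/
noncomputable def ouFilterFrom (θ p t : ℝ) (h : ℝ → ℝ) : ℝ :=
  h t - Real.exp (-θ * (t - p)) * h p - θ * ∫ r in p..t, Real.exp (-θ * (t - r)) * h r

lemma continuous_expKernel_mul (θ t : ℝ) {h : ℝ → ℝ} (hh : Continuous h) :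
    Continuous fun r => Real.exp (-θ * (t - r)) * h r := by fun_prop

/-- The exponential kernel factors through time `p`, so what was accumulated before `p` reaches `t`
only through a damping factor. -/
lemma ouFilter_eq_from (θ p t : ℝ) {h : ℝ → ℝ} (hh : Continuous h) :
    ouFilter θ t h = ouFilterFrom θ p t h + Real.exp (-θ * (t - p)) * ouFilter θ p h := by
  have hc := continuous_expKernel_mul θ t hh
  have h1 := intervalIntegral.integral_add_adjacent_intervals
    (hc.intervalIntegrable 0 p) (hc.intervalIntegrable (μ := volume) p t)
  have h2 : ∫ r in (0 : ℝ)..p, Real.exp (-θ * (t - r)) * h r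
      = Real.exp (-θ * (t - p)) * ∫ r in (0 : ℝ)..p, Real.exp (-θ * (p - r)) * h r := by
    rw [← intervalIntegral.integral_const_mul]
    refine intervalIntegral.integral_congr fun r _ => ?_
    rw [← mul_assoc, ← Real.exp_add]
    ring_nf
  simp only [ouFilter, ouFilterFrom]
  rw [← h1, h2]
  ring

lemma ouFilter_eq_from_zero (θ t : ℝ) {h : ℝ → ℝ} (h0 : h 0 = 0) :
    ouFilter θ t h = ouFilterFrom θ 0 t h := by
  simp [ouFilter, ouFilterFrom, h0]

lemma integral_expKernel {θ : ℝ} (hθ : θ ≠ 0) (p t : ℝ) :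
    ∫ r in p..t, Real.exp (-θ * (t - r)) = (1 - Real.exp (-θ * (t - p))) / θ := by
  have hd : ∀ r ∈ Set.uIcc p t,
      HasDerivAt (fun r => Real.exp (-θ * (t - r)) / θ) (Real.exp (-θ * (t - r))) r := by
    intro r _
    have := ((((hasDerivAt_id r).const_sub t).const_mul (-θ)).exp).div_const θ
    refine this.congr_deriv ?_
    simp only [id]; field_simp
  rw [intervalIntegral.integral_eq_sub_of_hasDerivAt hd
    (Continuous.intervalIntegrable (by fun_prop) _ _)]
  simp
  ring

lemma integral_expKernel_mul_sub {θ : ℝ} (hθ : θ ≠ 0) (p t : ℝ) :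
    θ * ∫ r in p..t, Real.exp (-θ * (t - r)) * (t - r)
      = 1 / θ - Real.exp (-θ * (t - p)) * ((t - p) + 1 / θ) := by
  have hd : ∀ r ∈ Set.uIcc p t,
      HasDerivAt (fun r => Real.exp (-θ * (t - r)) * ((t - r) + 1 / θ))
        (θ * (Real.exp (-θ * (t - r)) * (t - r))) r := by
    intro r _
    have := ((((hasDerivAt_id r).const_sub t).const_mul (-θ)).exp).mul
      (((hasDerivAt_id r).const_sub t).add_const (1 / θ))
    refine this.congr_deriv ?_
    simp only [id]; field_simp; ring
  rw [← intervalIntegral.integral_const_mul, intervalIntegral.integral_eq_sub_of_hasDerivAt hd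
    (Continuous.intervalIntegrable (by fun_prop) _ _)]
  simp

/-- Rewritten with the increments `h t - h r`, the functional is monotone in their size, and for the
linear path it is the integral of the exponential kernel, at most `1 / θ`. Only increments ending at
`t` matter. -/
lemma abs_ouFilterFrom_le {θ p t c : ℝ} (hθ : 0 < θ) (hpt : p ≤ t) {h : ℝ → ℝ}
    (hh : Continuous h) (hc0 : 0 ≤ c) (hc : ∀ r ∈ Set.Icc p t, |h t - h r| ≤ c * (t - r)) :
    |ouFilterFrom θ p t h| ≤ c / θ := by
  have e1 : ouFilterFrom θ p t h = Real.exp (-θ * (t - p)) * (h t - h p)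
      + θ * ∫ r in p..t, Real.exp (-θ * (t - r)) * (h t - h r) := by
    have : ∫ r in p..t, Real.exp (-θ * (t - r)) * (h t - h r)
        = (∫ r in p..t, Real.exp (-θ * (t - r))) * h t
          - ∫ r in p..t, Real.exp (-θ * (t - r)) * h r := by
      rw [← intervalIntegral.integral_mul_const, ← intervalIntegral.integral_sub
        (Continuous.intervalIntegrable (by fun_prop) _ _)
        (Continuous.intervalIntegrable (by fun_prop) _ _)]
      simp only [mul_sub]
    rw [this, integral_expKernel hθ.ne', ouFilterFrom]
    field_simp
    ring
  have e2 : |∫ r in p..t, Real.exp (-θ * (t - r)) * (h t - h r)|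
      ≤ c * ∫ r in p..t, Real.exp (-θ * (t - r)) * (t - r) := by
    rw [← intervalIntegral.integral_const_mul, ← Real.norm_eq_abs]
    refine intervalIntegral.norm_integral_le_of_norm_le hpt (Filter.Eventually.of_forall ?_)
      (Continuous.intervalIntegrable (by fun_prop) _ _)
    intro r hr
    rw [Real.norm_eq_abs, abs_mul, abs_of_pos (Real.exp_pos _)]
    calc _ ≤ Real.exp (-θ * (t - r)) * (c * (t - r)) := by
          gcongr; exact hc r ⟨hr.1.le, hr.2⟩
      _ = _ := by ring
  have e3 := hc p ⟨le_rfl, hpt⟩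
  have e4 := integral_expKernel_mul_sub hθ.ne' p t
  rw [e1]
  calc _ ≤ |Real.exp (-θ * (t - p)) * (h t - h p)|
        + |θ * ∫ r in p..t, Real.exp (-θ * (t - r)) * (h t - h r)| := abs_add_le _ _
    _ ≤ Real.exp (-θ * (t - p)) * (c * (t - p))
        + θ * (c * ∫ r in p..t, Real.exp (-θ * (t - r)) * (t - r)) := by
      rw [abs_mul, abs_mul, abs_of_pos (Real.exp_pos _), abs_of_pos hθ]
      gcongr
    _ = Real.exp (-θ * (t - p)) * (c * (t - p))
        + c * (1 / θ - Real.exp (-θ * (t - p)) * ((t - p) + 1 / θ)) := by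
      rw [← e4]; ring
    _ = c / θ - c * Real.exp (-θ * (t - p)) / θ := by ring
    _ ≤ c / θ := by
      have : 0 ≤ c * Real.exp (-θ * (t - p)) / θ := by positivity
      linarith

lemma ouFilter_const {θ : ℝ} (hθ : θ ≠ 0) (t c : ℝ) :
    ouFilter θ t (fun _ => c) = Real.exp (-θ * t) * c := by
  rw [ouFilter, intervalIntegral.integral_mul_const, integral_expKernel hθ]
  field_simp
  simp

lemma ouFilter_add (θ t : ℝ) {g h : ℝ → ℝ} (hg : Continuous g) (hh : Continuous h) :
    ouFilter θ t (fun x => g x + h x) = ouFilter θ t g + ouFilter θ t h := by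
  simp only [ouFilter, mul_add]
  rw [intervalIntegral.integral_add
        (Continuous.intervalIntegrable (by fun_prop) _ _)
        (Continuous.intervalIntegrable (by fun_prop) _ _)]
  ring

lemma ouFilter_const_mul (θ t c : ℝ) (h : ℝ → ℝ) :
    ouFilter θ t (fun x => c * h x) = c * ouFilter θ t h := by
  simp only [ouFilter, mul_left_comm _ c]
  rw [intervalIntegral.integral_const_mul]
  ring

lemma ouFilter_sub (θ t : ℝ) {g h : ℝ → ℝ} (hg : Continuous g) (hh : Continuous h) :
    ouFilter θ t (fun x => g x - h x) = ouFilter θ t g - ouFilter θ t h := by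
  have := ouFilter_add θ t hg (hh.const_mul (-1))
  rw [ouFilter_const_mul] at this
  simpa [sub_eq_add_neg] using this

lemma ouFilter_congr (θ : ℝ) {t : ℝ} (ht : 0 ≤ t) {g h : ℝ → ℝ}
    (hgh : ∀ x, 0 ≤ x → x ≤ t → g x = h x) : ouFilter θ t g = ouFilter θ t h := by
  rw [ouFilter, ouFilter, hgh t ht le_rfl]
  congr 2
  refine intervalIntegral.integral_congr fun r hr => ?_
  rw [Set.uIcc_of_le ht] at hr
  simp only [hgh r hr.1 hr.2]

/-- The factor `2` counts the endpoint value once and the kernel `θ * exp (-θ (t - r))`, of mass at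
most `1`, once. -/
lemma abs_ouFilter_le {θ t M : ℝ} (hθ : 0 < θ) (ht : 0 ≤ t) {h : ℝ → ℝ}
    (hM : ∀ r ∈ Set.Icc 0 t, |h r| ≤ M) : |ouFilter θ t h| ≤ 2 * M := by
  have hM0 : 0 ≤ M := (abs_nonneg _).trans (hM t ⟨ht, le_rfl⟩)
  have e2 : |∫ r in (0 : ℝ)..t, Real.exp (-θ * (t - r)) * h r|
      ≤ M * ∫ r in (0 : ℝ)..t, Real.exp (-θ * (t - r)) := by
    rw [← intervalIntegral.integral_const_mul, ← Real.norm_eq_abs]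
    refine intervalIntegral.norm_integral_le_of_norm_le ht (Filter.Eventually.of_forall ?_)
      (Continuous.intervalIntegrable (by fun_prop) _ _)
    intro r hr
    rw [Real.norm_eq_abs, abs_mul, abs_of_pos (Real.exp_pos _), mul_comm]
    gcongr
    exact hM r ⟨hr.1.le, hr.2⟩
  rw [integral_expKernel hθ.ne'] at e2
  rw [ouFilter]
  have h3 : M * ((1 - Real.exp (-θ * (t - 0))) / θ) ≤ M / θ := by
    rw [mul_div_assoc']
    gcongr
    have := Real.exp_pos (-θ * (t - 0))
    nlinarith
  calc _ ≤ |h t| + |θ * ∫ r in (0 : ℝ)..t, Real.exp (-θ * (t - r)) * h r| := abs_sub _ _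
    _ ≤ M + θ * (M / θ) := by
      rw [abs_mul, abs_of_pos hθ]
      gcongr
      · exact hM t ⟨ht, le_rfl⟩
      · exact e2.trans h3
    _ = 2 * M := by field_simp; ring

lemma continuous_ouFilter_right (θ s : ℝ) {Q : ℝ → ℝ → ℝ} (hQ : Continuous (Function.uncurry Q)) :
    Continuous fun x => ouFilter θ s (Q x) := by
  have h1 : Continuous fun x => Q x s := hQ.comp (by fun_prop : Continuous fun x => (x, s))
  unfold ouFilter
  refine h1.sub (continuous_const.mul ?_)
  refine intervalIntegral.continuous_parametric_intervalIntegral_of_continuous' ?_ 0 s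
  have h2 : Continuous fun p : ℝ × ℝ => Q p.1 p.2 := hQ
  fun_prop

lemma continuous_section {Q : ℝ → ℝ → ℝ} (hQ : Continuous (Function.uncurry Q)) (x : ℝ) :
    Continuous (Q x) := hQ.comp (by fun_prop : Continuous fun y => (x, y))

/-- A kernel vanishing on the axis whose rectangular increments away from the diagonal are small
contributes little to the covariance of the filtered process. -/
lemma abs_ouFilter_ouFilter_sub_le {θ p t s c : ℝ} (hθ : 0 < θ) (hpt : p ≤ t) (hs : 0 ≤ s)
    {Q : ℝ → ℝ → ℝ} (hQ : Continuous (Function.uncurry Q)) (hc : 0 ≤ c)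
    (hQ0 : ∀ x, p ≤ x → Q x 0 = 0)
    (hrect : ∀ x ∈ Set.Icc p t, ∀ u ∈ Set.Icc 0 s,
      |(Q t s - Q x s) - (Q t u - Q x u)| ≤ c * (t - x) * (s - u)) :
    |ouFilter θ t (fun x => ouFilter θ s (Q x))
      - Real.exp (-θ * (t - p)) * ouFilter θ p (fun x => ouFilter θ s (Q x))| ≤ c / θ ^ 2 := by
  have hφ := continuous_ouFilter_right θ s hQ
  rw [ouFilter_eq_from θ p t hφ, add_sub_cancel_right, pow_two, ← div_div]
  -- The one-variable bound is used twice, each time costing `1 / θ`: in `x` on `[p, t]`, and then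
  -- in the second variable on `[0, s]`, where vanishing on the axis removes the boundary term at
  -- `0`.
  refine abs_ouFilterFrom_le hθ hpt hφ (by positivity) fun x hx => ?_
  rw [← ouFilter_sub θ s (continuous_section hQ t) (continuous_section hQ x),
    ouFilter_eq_from_zero θ s (by simp [hQ0 t hpt, hQ0 x hx.1]), div_mul_eq_mul_div]
  have hx' : 0 ≤ t - x := sub_nonneg.2 hx.2
  exact abs_ouFilterFrom_le hθ hs
    ((continuous_section hQ t).sub (continuous_section hQ x)) (by positivity) (hrect x hx)

/-! ### Increments of powers and the covariance kernels -/

lemma abs_rpow_sub_rpow_le {b D x y : ℝ} (hb : b ≤ 1) (hD : 0 < D) (hx : D ≤ x) (hy : D ≤ y) :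
    |y ^ b - x ^ b| ≤ |b| * D ^ (b - 1) * |y - x| := by
  have hC : ∀ z ∈ Set.Ici D, ‖b * z ^ (b - 1)‖ ≤ |b| * D ^ (b - 1) := fun z hz => by
    rw [Real.norm_eq_abs, abs_mul, abs_of_pos (Real.rpow_pos_of_pos (hD.trans_le hz) _)]
    exact mul_le_mul_of_nonneg_left (Real.rpow_le_rpow_of_nonpos hD hz (by linarith))
      (abs_nonneg b)
  have := (convex_Ici D).norm_image_sub_le_of_norm_hasDerivWithin_le
    (fun z hz => (Real.hasDerivAt_rpow_const (p := b)
      (Or.inl (hD.trans_le hz).ne')).hasDerivWithinAt) hC hx hy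
  simpa [Real.norm_eq_abs] using this

/-- The mean value inequality is applied to `z ↦ (z + k) ^ a - z ^ a`, and again to its derivative.
Intersecting with `[D - k, ∞)` keeps both `z` and `z + k` above `D` for either sign of `k`. -/
lemma abs_rpow_rect_le {a D x y k : ℝ} (ha0 : 0 < a) (ha : a < 2) (hD : 0 < D) (hx : D ≤ x)
    (hy : D ≤ y) (hxk : D ≤ x + k) (hyk : D ≤ y + k) :
    |((y + k) ^ a - y ^ a) - ((x + k) ^ a - x ^ a)| ≤ 2 * D ^ (a - 2) * |k| * |y - x| := by
  have hab : a * |a - 1| ≤ 2 := by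
    rcases abs_cases (a - 1) with h | h <;> rw [h.1] <;> nlinarith
  have := ((convex_Ici D).inter (convex_Ici (D - k))).norm_image_sub_le_of_norm_hasDerivWithin_le
    (f := fun x : ℝ => (x + k) ^ a - x ^ a)
    (f' := fun x => a * (x + k) ^ (a - 1) - a * x ^ (a - 1)) (C := 2 * D ^ (a - 2) * |k|)
    (x := x) (y := y)
    (fun z hz => by
      have h1 : D ≤ z := hz.1
      have h2 : D - k ≤ z := hz.2
      have h3 : z + k ≠ 0 := by linarith
      have h4 := ((hasDerivAt_id z).add_const k).rpow_const (p := a) (Or.inl h3)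
      have h5 := Real.hasDerivAt_rpow_const (x := z) (p := a) (Or.inl (by linarith))
      refine ((h4.sub h5).congr_deriv ?_).hasDerivWithinAt
      simp)
    (fun z hz => by
      have h1 : D ≤ z := hz.1
      have h2 : D - k ≤ z := hz.2
      have := abs_rpow_sub_rpow_le (b := a - 1) (x := z) (y := z + k) (by linarith) hD h1
        (by linarith)
      rw [Real.norm_eq_abs, ← mul_sub, abs_mul, abs_of_pos ha0]
      rw [add_sub_cancel_left, show a - 1 - 1 = a - 2 by ring] at this
      calc _ ≤ a * (|a - 1| * D ^ (a - 2) * |k|) := by gcongr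
        _ = (a * |a - 1|) * (D ^ (a - 2) * |k|) := by ring
        _ ≤ 2 * (D ^ (a - 2) * |k|) := by gcongr
        _ = _ := by ring)
    ⟨hx, by simpa using hxk⟩ ⟨hy, by simpa using hyk⟩
  simpa [Real.norm_eq_abs] using this

/-- The covariance of sub-fractional Brownian motion with parameter `a / 2`, extended to `ℝ²`. -/
noncomputable def subfBmCov (a x y : ℝ) : ℝ :=
  |x| ^ a + |y| ^ a - 1 / 2 * (|x + y| ^ a + |x - y| ^ a)

/-- The covariance of fractional Brownian motion with parameter `a / 2`. -/
noncomputable def fBmCov (a x y : ℝ) : ℝ :=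
  1 / 2 * (|x| ^ a + |y| ^ a - |x - y| ^ a)

/-- The difference between the sub-fractional and the fractional Brownian covariances. -/
noncomputable def reflectedCov (a x y : ℝ) : ℝ :=
  1 / 2 * (|x| ^ a + |y| ^ a - |x + y| ^ a)

lemma subfBmCov_eq (a x y : ℝ) : subfBmCov a x y = fBmCov a x y + reflectedCov a x y := by
  simp only [subfBmCov, fBmCov, reflectedCov]; ring

lemma continuous_abs_rpow {a : ℝ} (ha : 0 < a) : Continuous fun x : ℝ => |x| ^ a :=
  continuous_abs.rpow_const fun _ => Or.inr ha.le

lemma continuous_fBmCov {a : ℝ} (ha : 0 < a) : Continuous (Function.uncurry (fBmCov a)) := by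
  have h := continuous_abs_rpow ha
  have h1 : Continuous fun p : ℝ × ℝ => |p.1 - p.2| ^ a :=
    h.comp (continuous_fst.sub continuous_snd)
  exact continuous_const.mul (((h.comp continuous_fst).add (h.comp continuous_snd)).sub h1)

lemma continuous_reflectedCov {a : ℝ} (ha : 0 < a) :
    Continuous (Function.uncurry (reflectedCov a)) := by
  have h := continuous_abs_rpow ha
  have h1 : Continuous fun p : ℝ × ℝ => |p.1 + p.2| ^ a :=
    h.comp (continuous_fst.add continuous_snd)
  exact continuous_const.mul (((h.comp continuous_fst).add (h.comp continuous_snd)).sub h1)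

lemma continuous_subfBmCov {a : ℝ} (ha : 0 < a) :
    Continuous (Function.uncurry (subfBmCov a)) := by
  refine ((continuous_fBmCov ha).add (continuous_reflectedCov ha)).congr fun p => ?_
  exact (subfBmCov_eq a p.1 p.2).symm

lemma subfBmCov_zero_right {a : ℝ} (ha : 0 < a) (x : ℝ) : subfBmCov a x 0 = 0 := by
  simp [subfBmCov, Real.zero_rpow ha.ne']; ring

lemma reflectedCov_zero_right {a : ℝ} (ha : 0 < a) (x : ℝ) : reflectedCov a x 0 = 0 := by
  simp [reflectedCov, Real.zero_rpow ha.ne']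

/-- Functions of one variable cancel in a rectangular increment; only `(x + y) ^ a` survives, with
arguments at least `p`. -/
lemma abs_reflectedCov_rect_le {a D p t s x u : ℝ} (ha0 : 0 < a) (ha : a < 2) (hD : 0 < D)
    (hDp : D ≤ p) (hx : x ∈ Set.Icc p t) (hu : u ∈ Set.Icc 0 s) :
    |(reflectedCov a t s - reflectedCov a x s) - (reflectedCov a t u - reflectedCov a x u)|
      ≤ D ^ (a - 2) * (t - x) * (s - u) := by
  obtain ⟨hx1, hx2⟩ := hx
  obtain ⟨hu1, hu2⟩ := hu
  have h := abs_rpow_rect_le (x := x + u) (y := x + s) (k := t - x) ha0 ha hD (by linarith)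
    (by linarith) (by linarith) (by linarith)
  rw [show x + s + (t - x) = t + s by ring, show x + u + (t - x) = t + u by ring,
    show x + s - (x + u) = s - u by ring, abs_of_nonneg (sub_nonneg.2 hx2),
    abs_of_nonneg (sub_nonneg.2 hu2)] at h
  have e : (reflectedCov a t s - reflectedCov a x s) - (reflectedCov a t u - reflectedCov a x u)
      = -(1 / 2) * (((t + s) ^ a - (x + s) ^ a) - ((t + u) ^ a - (x + u) ^ a)) := by
    simp only [reflectedCov]
    rw [abs_of_nonneg (show 0 ≤ t + s by linarith), abs_of_nonneg (show 0 ≤ x + s by linarith),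
      abs_of_nonneg (show 0 ≤ t + u by linarith), abs_of_nonneg (show 0 ≤ x + u by linarith)]
    ring
  rw [e, abs_mul, show |(-(1 / 2) : ℝ)| = 1 / 2 by norm_num]
  linarith

/-- The rectangle `[p, t] × [0, s]` stays at distance `D` from the diagonal, so `(x - y) ^ a` is as
tame there as `(x + y) ^ a`; each contributes half of the constant. -/
lemma abs_subfBmCov_rect_le {a D p t s x u : ℝ} (ha0 : 0 < a) (ha : a < 2) (hD : 0 < D)
    (hs : 0 ≤ s) (hDp : D ≤ p - s) (hx : x ∈ Set.Icc p t) (hu : u ∈ Set.Icc 0 s) :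
    |(subfBmCov a t s - subfBmCov a x s) - (subfBmCov a t u - subfBmCov a x u)|
      ≤ 2 * D ^ (a - 2) * (t - x) * (s - u) := by
  have h0 := abs_reflectedCov_rect_le ha0 ha hD (by linarith : D ≤ p) hx hu
  obtain ⟨hx1, hx2⟩ := hx
  obtain ⟨hu1, hu2⟩ := hu
  have h := abs_rpow_rect_le (x := x - u) (y := x - s) (k := t - x) ha0 ha hD (by linarith)
    (by linarith) (by linarith) (by linarith)
  rw [show x - s + (t - x) = t - s by ring, show x - u + (t - x) = t - u by ring,
    show x - s - (x - u) = -(s - u) by ring, abs_neg, abs_of_nonneg (sub_nonneg.2 hx2),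
    abs_of_nonneg (sub_nonneg.2 hu2)] at h
  have e : (subfBmCov a t s - subfBmCov a x s) - (subfBmCov a t u - subfBmCov a x u)
      = ((reflectedCov a t s - reflectedCov a x s) - (reflectedCov a t u - reflectedCov a x u))
        + -(1 / 2) * (((t - s) ^ a - (x - s) ^ a) - ((t - u) ^ a - (x - u) ^ a)) := by
    simp only [subfBmCov_eq, fBmCov]
    rw [abs_of_nonneg (show 0 ≤ t - s by linarith), abs_of_nonneg (show 0 ≤ x - s by linarith),
      abs_of_nonneg (show 0 ≤ t - u by linarith), abs_of_nonneg (show 0 ≤ x - u by linarith)]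
    ring
  rw [e]
  refine (abs_add_le _ _).trans ?_
  rw [abs_mul, show |(-(1 / 2) : ℝ)| = 1 / 2 by norm_num]
  linarith

lemma abs_reflectedCov_le {a m x y : ℝ} (ha : 0 < a) (hx : x ∈ Set.Icc 0 m)
    (hy : y ∈ Set.Icc 0 m) : |reflectedCov a x y| ≤ 2 * (2 * m) ^ a := by
  obtain ⟨hx1, hx2⟩ := hx
  obtain ⟨hy1, hy2⟩ := hy
  have h1 : |x| ^ a ≤ (2 * m) ^ a := by
    apply Real.rpow_le_rpow (abs_nonneg _) _ ha.le; rw [abs_of_nonneg hx1]; linarith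
  have h2 : |y| ^ a ≤ (2 * m) ^ a := by
    apply Real.rpow_le_rpow (abs_nonneg _) _ ha.le; rw [abs_of_nonneg hy1]; linarith
  have h3 : |x + y| ^ a ≤ (2 * m) ^ a := by
    apply Real.rpow_le_rpow (abs_nonneg _) _ ha.le; rw [abs_le]; constructor <;> linarith
  have := Real.rpow_nonneg (abs_nonneg x) a
  have := Real.rpow_nonneg (abs_nonneg y) a
  have := Real.rpow_nonneg (abs_nonneg (x + y)) a
  rw [reflectedCov, abs_le]
  constructor <;> linarith

lemma abs_subfBmCov_le {a m x y : ℝ} (ha : 0 < a) (hx : x ∈ Set.Icc 0 m)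
    (hy : y ∈ Set.Icc 0 m) : |subfBmCov a x y| ≤ 3 * (2 * m) ^ a := by
  obtain ⟨hx1, hx2⟩ := hx
  obtain ⟨hy1, hy2⟩ := hy
  have h1 : |x| ^ a ≤ (2 * m) ^ a := by
    apply Real.rpow_le_rpow (abs_nonneg _) _ ha.le; rw [abs_of_nonneg hx1]; linarith
  have h2 : |y| ^ a ≤ (2 * m) ^ a := by
    apply Real.rpow_le_rpow (abs_nonneg _) _ ha.le; rw [abs_of_nonneg hy1]; linarith
  have h3 : |x + y| ^ a ≤ (2 * m) ^ a := by
    apply Real.rpow_le_rpow (abs_nonneg _) _ ha.le; rw [abs_le]; constructor <;> linarith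
  have h4 : |x - y| ^ a ≤ (2 * m) ^ a := by
    apply Real.rpow_le_rpow (abs_nonneg _) _ ha.le; rw [abs_le]; constructor <;> linarith
  have := Real.rpow_nonneg (abs_nonneg x) a
  have := Real.rpow_nonneg (abs_nonneg y) a
  have := Real.rpow_nonneg (abs_nonneg (x + y)) a
  have := Real.rpow_nonneg (abs_nonneg (x - y)) a
  rw [subfBmCov, abs_le]
  constructor <;> linarith

/-! ### Exponential damping and the reflected kernel -/

/-- The constant `8 / θ ^ 2` comes from `y ^ 2 / 2 ≤ exp y` at `y = θ * (t / 2)`. -/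
lemma exp_neg_mul_half_le {a θ t : ℝ} (hθ : 0 < θ) (ht : 0 < t) :
    Real.exp (-θ * (t / 2)) * t ^ a ≤ 8 / θ ^ 2 * t ^ (a - 2) := by
  have h1 : (θ * (t / 2)) ^ 2 / 2 ≤ Real.exp (θ * (t / 2)) := by
    have := Real.quadratic_le_exp_of_nonneg (x := θ * (t / 2)) (by positivity)
    have : 0 < θ * (t / 2) := by positivity
    linarith
  have h2 : t ^ a = t ^ (a - 2) * t ^ 2 := by
    rw [← Real.rpow_natCast, ← Real.rpow_add ht]; norm_num
  have h3 : Real.exp (-θ * (t / 2)) * t ^ 2 ≤ 8 / θ ^ 2 := by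
    rw [neg_mul, Real.exp_neg, inv_mul_le_iff₀ (Real.exp_pos _)]
    calc t ^ 2 = (θ * (t / 2)) ^ 2 / 2 * (8 / θ ^ 2) := by field_simp; norm_num
      _ ≤ _ := by gcongr
  rw [h2]
  have := Real.rpow_nonneg ht.le (a - 2)
  nlinarith

lemma exp_neg_mul_half_le_rpow {a θ t : ℝ} (ha : 0 ≤ a) (hθ : 0 < θ) (ht : 1 ≤ t) :
    Real.exp (-θ * (t / 2)) ≤ 8 / θ ^ 2 * t ^ (a - 2) :=
  le_trans (le_mul_of_one_le_right (Real.exp_pos _).le (Real.one_le_rpow ht ha))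
    (exp_neg_mul_half_le hθ (by linarith))

lemma abs_ouFilter_ouFilter_reflectedCov_le {a θ t : ℝ} (ha0 : 0 < a) (ha : a < 2) (hθ : 0 < θ)
    (ht : 0 < t) :
    |ouFilter θ t (fun x => ouFilter θ t (reflectedCov a x))|
      ≤ (((1 / 2 : ℝ) ^ (a - 2) + 64 * 2 ^ a) / θ ^ 2) * t ^ (a - 2) := by
  have h1 := abs_ouFilter_ouFilter_sub_le (θ := θ) (p := t / 2) (t := t) (s := t)
    (c := (t / 2) ^ (a - 2)) hθ (by linarith) ht.le (continuous_reflectedCov ha0) (by positivity)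
    (fun x _ => reflectedCov_zero_right ha0 x)
    (fun x hx u hu => abs_reflectedCov_rect_le ha0 ha (by positivity) le_rfl hx hu)
  have h2 : |ouFilter θ (t / 2) (fun x => ouFilter θ t (reflectedCov a x))|
      ≤ 2 * (2 * (2 * (2 * t) ^ a)) := by
    refine abs_ouFilter_le hθ (by positivity) fun x hx => abs_ouFilter_le hθ ht.le fun y hy => ?_
    exact abs_reflectedCov_le ha0 ⟨hx.1, by linarith [hx.2]⟩ hy
  have h3 := exp_neg_mul_half_le (a := a) hθ ht
  set A := ouFilter θ t (fun x => ouFilter θ t (reflectedCov a x))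
  set B := ouFilter θ (t / 2) (fun x => ouFilter θ t (reflectedCov a x))
  rw [show t - t / 2 = t / 2 by ring] at h1
  calc |A| ≤ |A - Real.exp (-θ * (t / 2)) * B| + |Real.exp (-θ * (t / 2)) * B| := by
        have := abs_add_le (A - Real.exp (-θ * (t / 2)) * B) (Real.exp (-θ * (t / 2)) * B)
        simpa using this
    _ ≤ (t / 2) ^ (a - 2) / θ ^ 2 + Real.exp (-θ * (t / 2)) * (2 * (2 * (2 * (2 * t) ^ a))) := by
      rw [abs_mul, abs_of_pos (Real.exp_pos _)]
      gcongr
    _ = (1 / 2) ^ (a - 2) / θ ^ 2 * t ^ (a - 2)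
        + 8 * 2 ^ a * (Real.exp (-θ * (t / 2)) * t ^ a) := by
      rw [div_eq_mul_one_div t 2, Real.mul_rpow ht.le (by norm_num),
        Real.mul_rpow (by norm_num) ht.le]
      ring
    _ ≤ (1 / 2) ^ (a - 2) / θ ^ 2 * t ^ (a - 2)
        + 8 * 2 ^ a * (8 / θ ^ 2 * t ^ (a - 2)) := by gcongr
    _ = _ := by ring

/-! ### The fractional Brownian kernel, computed exactly -/

/-- The incomplete Laplace transform of `z ↦ z ^ a`. -/
noncomputable def laplaceRpow (a θ u : ℝ) : ℝ := ∫ z in (0 : ℝ)..u, Real.exp (-θ * z) * |z| ^ a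

lemma integrableOn_exp_mul_rpow {a θ : ℝ} (ha : 0 < a) (hθ : 0 < θ) :
    IntegrableOn (fun z : ℝ => Real.exp (-θ * z) * |z| ^ a) (Set.Ioi 0) := by
  have h := integrableOn_rpow_mul_exp_neg_mul_rpow (p := 1) (s := a) (b := θ) (by linarith)
    one_pos hθ
  refine h.congr_fun (fun z hz => ?_) measurableSet_Ioi
  simp only [Real.rpow_one, abs_of_pos (Set.mem_Ioi.1 hz), mul_comm (z ^ a)]

lemma integral_exp_mul_rpow {a θ : ℝ} (ha : 0 < a) (hθ : 0 < θ) :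
    ∫ z in Set.Ioi (0 : ℝ), Real.exp (-θ * z) * |z| ^ a = Real.Gamma (a + 1) / θ ^ (a + 1) := by
  have h := Real.integral_rpow_mul_exp_neg_mul_Ioi (a := a + 1) (r := θ) (by linarith) hθ
  rw [Real.div_rpow zero_le_one hθ.le, Real.one_rpow, one_div_mul_eq_div] at h
  rw [← h]
  refine setIntegral_congr_fun measurableSet_Ioi fun z hz => ?_
  simp only [abs_of_pos (Set.mem_Ioi.1 hz), add_sub_cancel_right, neg_mul, mul_comm (z ^ a)]

/-- In the tail integral half of the exponential gives the decay in `u`; the other half keeps the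
integral finite. -/
lemma laplaceRpow_bounds {a θ u : ℝ} (ha : 0 < a) (hθ : 0 < θ) (hu : 0 ≤ u) :
    |laplaceRpow a θ u - Real.Gamma (a + 1) / θ ^ (a + 1)|
      ≤ Real.exp (-θ * (u / 2)) * (Real.Gamma (a + 1) / (θ / 2) ^ (a + 1)) := by
  have hi := integrableOn_exp_mul_rpow ha hθ
  have hi2 := integrableOn_exp_mul_rpow ha (half_pos hθ)
  have hu' : Set.Ioi u ⊆ Set.Ioi 0 := Set.Ioi_subset_Ioi hu
  have h1 : laplaceRpow a θ u - Real.Gamma (a + 1) / θ ^ (a + 1)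
      = -∫ z in Set.Ioi u, Real.exp (-θ * z) * |z| ^ a := by
    rw [← integral_exp_mul_rpow ha hθ, laplaceRpow,
      ← intervalIntegral.integral_Ioi_sub_Ioi hi hu]
    ring
  have h2 : 0 ≤ ∫ z in Set.Ioi u, Real.exp (-θ * z) * |z| ^ a :=
    setIntegral_nonneg measurableSet_Ioi fun z _ => by positivity
  rw [h1, abs_neg, abs_of_nonneg h2, ← integral_exp_mul_rpow ha (half_pos hθ)]
  calc _ ≤ ∫ z in Set.Ioi u, Real.exp (-θ * (u / 2)) * (Real.exp (-(θ / 2) * z) * |z| ^ a) := by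
        refine setIntegral_mono_on (hi.mono_set hu') ((hi2.mono_set hu').const_mul _)
          measurableSet_Ioi fun z hz => ?_
        rw [← mul_assoc, ← Real.exp_add]
        gcongr
        have : u < z := hz
        nlinarith
    _ = Real.exp (-θ * (u / 2)) * ∫ z in Set.Ioi u, Real.exp (-(θ / 2) * z) * |z| ^ a :=
        integral_const_mul _ _
    _ ≤ _ := by
        gcongr
        · exact Filter.Eventually.of_forall fun z => by
            simp only [Pi.zero_apply]; positivity

lemma continuous_laplaceRpow {a : ℝ} (ha : 0 < a) (θ : ℝ) : Continuous (laplaceRpow a θ) := by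
  have h := continuous_abs_rpow ha
  exact intervalIntegral.continuous_primitive
    (fun _ _ => Continuous.intervalIntegrable (by fun_prop) _ _) 0

lemma integral_expKernel_mul_abs_sub_rpow (a θ u : ℝ) :
    ∫ r in (0 : ℝ)..u, Real.exp (-θ * (u - r)) * |u - r| ^ a = laplaceRpow a θ u := by
  rw [laplaceRpow]
  simpa using intervalIntegral.integral_comp_sub_left (a := 0) (b := u)
    (fun z => Real.exp (-θ * z) * |z| ^ a) u

lemma abs_rpow_eq_max_add_max {a : ℝ} (ha : 0 < a) (x : ℝ) :
    |x| ^ a = |max x 0| ^ a + |max (-x) 0| ^ a := by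
  rcases le_total 0 x with h | h
  · rw [max_eq_left h, max_eq_right (by linarith : -x ≤ 0), abs_zero, Real.zero_rpow ha.ne',
      add_zero]
  · rw [max_eq_right h, max_eq_left (by linarith : 0 ≤ -x), abs_zero, Real.zero_rpow ha.ne',
      zero_add, abs_neg]

/-- By symmetry the square is twice the triangle `r ≤ u`, where the two exponentials combine to `exp
(-2θ (t - u)) * exp (-θ (u - r))`. -/
lemma integral_integral_expKernel_abs_sub_rpow {a t : ℝ} (ha : 0 < a) (θ : ℝ) (ht : 0 ≤ t) :
    ∫ u in (0 : ℝ)..t, Real.exp (-θ * (t - u))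
        * ∫ r in (0 : ℝ)..t, Real.exp (-θ * (t - r)) * |u - r| ^ a
      = 2 * ∫ u in (0 : ℝ)..t, Real.exp (-(2 * θ) * (t - u)) * laplaceRpow a θ u := by
  -- The cutoff by `max` makes the triangle's integrand continuous on the whole square, so Fubini
  -- applies there.
  set F : ℝ → ℝ → ℝ := fun u r =>
    Real.exp (-θ * (t - u)) * (Real.exp (-θ * (t - r)) * |max (u - r) 0| ^ a) with hF
  have hp := continuous_abs_rpow ha
  have hFc : Continuous (Function.uncurry F) := by
    have : Continuous fun p : ℝ × ℝ => |max (p.1 - p.2) 0| ^ a :=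
      hp.comp ((continuous_fst.sub continuous_snd).max continuous_const)
    have e : Function.uncurry F = fun p : ℝ × ℝ => Real.exp (-θ * (t - p.1)) *
      (Real.exp (-θ * (t - p.2)) * |max (p.1 - p.2) 0| ^ a) := rfl
    rw [e]
    fun_prop
  have hF1 : ∀ u, Continuous (F u) := fun u => hFc.comp (by fun_prop : Continuous fun r => (u, r))
  have hF2 : ∀ r, Continuous fun u => F u r := fun r =>
    hFc.comp (by fun_prop : Continuous fun u => (u, r))
  have hFs : Continuous (Function.uncurry fun u r => F r u) := hFc.comp continuous_swap
  have hsplit : ∀ u, Real.exp (-θ * (t - u))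
        * ∫ r in (0 : ℝ)..t, Real.exp (-θ * (t - r)) * |u - r| ^ a
      = (∫ r in (0 : ℝ)..t, F u r) + ∫ r in (0 : ℝ)..t, F r u := by
    intro u
    rw [← intervalIntegral.integral_add ((hF1 u).intervalIntegrable _ _)
      ((hF2 u).intervalIntegrable _ _), ← intervalIntegral.integral_const_mul]
    refine intervalIntegral.integral_congr fun r _ => ?_
    simp only [hF]
    rw [abs_rpow_eq_max_add_max ha (u - r), neg_sub]
    ring
  have hswap : ∫ u in (0 : ℝ)..t, ∫ r in (0 : ℝ)..t, F r u
      = ∫ u in (0 : ℝ)..t, ∫ r in (0 : ℝ)..t, F u r := by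
    refine intervalIntegral_intervalIntegral_swap ?_
    refine (hFs.continuousOn.integrableOn_compact
      ((isCompact_uIcc (a := 0) (b := t)).prod (isCompact_uIcc (a := 0) (b := t)))).mono_set ?_
    exact Set.prod_mono Set.uIoc_subset_uIcc Set.uIoc_subset_uIcc
  have hinner : ∀ u ∈ Set.uIcc 0 t, ∫ r in (0 : ℝ)..t, F u r
      = Real.exp (-(2 * θ) * (t - u)) * laplaceRpow a θ u := by
    intro u hu
    rw [Set.uIcc_of_le ht] at hu
    rw [← intervalIntegral.integral_add_adjacent_intervals ((hF1 u).intervalIntegrable 0 u)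
      ((hF1 u).intervalIntegrable u t), ← integral_expKernel_mul_abs_sub_rpow]
    have hz : ∫ r in u..t, F u r = 0 := by
      rw [← intervalIntegral.integral_zero (a := u) (b := t) (μ := volume)]
      refine intervalIntegral.integral_congr fun r hr => ?_
      rw [Set.uIcc_of_le hu.2] at hr
      simp [hF, max_eq_right (sub_nonpos.2 hr.1), Real.zero_rpow ha.ne']
    rw [hz, add_zero, ← intervalIntegral.integral_const_mul]
    refine intervalIntegral.integral_congr fun r hr => ?_
    rw [Set.uIcc_of_le hu.1] at hr
    simp only [hF]
    rw [max_eq_left (sub_nonneg.2 hr.2), ← mul_assoc, ← mul_assoc, ← Real.exp_add,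
      ← Real.exp_add]
    ring_nf
  have hc1 : Continuous fun u => ∫ r in (0 : ℝ)..t, F u r :=
    intervalIntegral.continuous_parametric_intervalIntegral_of_continuous' hFc 0 t
  have hc2 : Continuous fun u => ∫ r in (0 : ℝ)..t, F r u :=
    intervalIntegral.continuous_parametric_intervalIntegral_of_continuous' hFs 0 t
  simp only [hsplit]
  rw [intervalIntegral.integral_add (hc1.intervalIntegrable _ _) (hc2.intervalIntegrable _ _),
    hswap, intervalIntegral.integral_congr hinner]
  ring

lemma ouFilter_ouFilter_abs_sub_rpow {a t : ℝ} (ha : 0 < a) (θ : ℝ) (ht : 0 ≤ t) :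
    ouFilter θ t (fun u => ouFilter θ t fun r => |u - r| ^ a)
      = -2 * θ * laplaceRpow a θ t + 2 * θ ^ 2 *
        ∫ u in (0 : ℝ)..t, Real.exp (-(2 * θ) * (t - u)) * laplaceRpow a θ u := by
  have hp := continuous_abs_rpow ha
  have hpc : Continuous fun p : ℝ × ℝ => |p.1 - p.2| ^ a :=
    hp.comp (continuous_fst.sub continuous_snd)
  have hpt : Continuous fun u : ℝ => |u - t| ^ a := hp.comp (continuous_id.sub continuous_const)
  have hc : Continuous fun u => ∫ r in (0 : ℝ)..t, Real.exp (-θ * (t - r)) * |u - r| ^ a := by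
    refine intervalIntegral.continuous_parametric_intervalIntegral_of_continuous'
      (f := fun u r => Real.exp (-θ * (t - r)) * |u - r| ^ a) ?_ 0 t
    have : Continuous fun p : ℝ × ℝ => Real.exp (-θ * (t - p.2)) * |p.1 - p.2| ^ a := by fun_prop
    exact this
  have h := integral_integral_expKernel_abs_sub_rpow ha θ ht
  have h2 : ∫ u in (0 : ℝ)..t, Real.exp (-θ * (t - u)) * |u - t| ^ a = laplaceRpow a θ t := by
    simp only [abs_sub_comm _ t]
    exact integral_expKernel_mul_abs_sub_rpow a θ t
  unfold ouFilter
  simp only [mul_sub]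
  rw [intervalIntegral.integral_sub (Continuous.intervalIntegrable (by fun_prop) _ _)
    (Continuous.intervalIntegrable (by fun_prop) _ _)]
  simp only [← mul_sub, mul_left_comm _ θ]
  rw [intervalIntegral.integral_const_mul, h, h2, integral_expKernel_mul_abs_sub_rpow]
  simp [Real.zero_rpow ha.ne']
  ring

/-- The filter sends constants to `exp (-θ t)` multiples, so the terms `|x| ^ a` and `|y| ^ a` only
leave a damped remainder; the limit comes from `|x - y| ^ a`. -/
lemma ouFilter_ouFilter_fBmCov {a θ t : ℝ} (ha : 0 < a) (hθ : 0 < θ) (ht : 0 ≤ t) :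
    ouFilter θ t (fun x => ouFilter θ t (fBmCov a x))
      = Real.exp (-θ * t) * ouFilter θ t (fun r => |r| ^ a) + θ * laplaceRpow a θ t
        - θ ^ 2 * ∫ u in (0 : ℝ)..t, Real.exp (-(2 * θ) * (t - u)) * laplaceRpow a θ u := by
  have hp := continuous_abs_rpow ha
  have hpc : Continuous fun p : ℝ × ℝ => |p.1 - p.2| ^ a :=
    hp.comp (continuous_fst.sub continuous_snd)
  have hps : ∀ x : ℝ, Continuous fun r : ℝ => |x - r| ^ a := fun x =>
    hp.comp (continuous_const.sub continuous_id)
  have e1 : ∀ x, ouFilter θ t (fBmCov a x) = 1 / 2 * Real.exp (-θ * t) * |x| ^ a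
      + (1 / 2 * ouFilter θ t (fun r => |r| ^ a)
        + -(1 / 2) * ouFilter θ t fun r => |x - r| ^ a) := by
    intro x
    have : fBmCov a x
        = fun r => 1 / 2 * |x| ^ a + (1 / 2 * |r| ^ a + -(1 / 2) * |x - r| ^ a) := by
      funext r; simp only [fBmCov]; ring
    have hx := hps x
    rw [this, ouFilter_add θ t continuous_const (by fun_prop),
      ouFilter_add θ t (by fun_prop) (by fun_prop), ouFilter_const hθ.ne', ouFilter_const_mul,
      ouFilter_const_mul]
    ring
  have hc : Continuous fun x => ouFilter θ t fun r => |x - r| ^ a :=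
    continuous_ouFilter_right θ t (Q := fun x r => |x - r| ^ a) hpc
  simp only [e1]
  rw [ouFilter_add θ t (by fun_prop) (by fun_prop), ouFilter_add θ t (by fun_prop) (by fun_prop),
    ouFilter_const hθ.ne', ouFilter_const_mul, ouFilter_const_mul,
    ouFilter_ouFilter_abs_sub_rpow ha θ ht]
  ring

lemma abs_integral_expKernel_mul_laplaceRpow_sub_le {a θ t : ℝ} (ha : 0 < a) (hθ : 0 < θ)
    (ht : 0 ≤ t) :
    |(∫ u in (0 : ℝ)..t, Real.exp (-(2 * θ) * (t - u)) * laplaceRpow a θ u)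
        - Real.Gamma (a + 1) / θ ^ (a + 1) / (2 * θ)|
      ≤ Real.exp (-θ * (t / 2)) * ((Real.Gamma (a + 1) / θ ^ (a + 1)
        + Real.Gamma (a + 1) / (θ / 2) ^ (a + 1)) / θ) := by
  have hg : 0 < Real.Gamma (a + 1) := Real.Gamma_pos_of_pos (by linarith)
  set J := Real.Gamma (a + 1) / θ ^ (a + 1)
  set E := Real.Gamma (a + 1) / (θ / 2) ^ (a + 1)
  have hJ : 0 ≤ J := by positivity
  have hE : 0 ≤ E := by positivity
  have hl := continuous_laplaceRpow ha θ
  have h1 : (∫ u in (0 : ℝ)..t, Real.exp (-(2 * θ) * (t - u)) * laplaceRpow a θ u)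
      = (∫ u in (0 : ℝ)..t, Real.exp (-(2 * θ) * (t - u)) * (laplaceRpow a θ u - J))
        + (1 - Real.exp (-(2 * θ) * t)) / (2 * θ) * J := by
    have h2 := integral_expKernel (θ := 2 * θ) (by positivity) 0 t
    rw [sub_zero] at h2
    rw [← h2, ← intervalIntegral.integral_mul_const, ← intervalIntegral.integral_add
      (Continuous.intervalIntegrable (by fun_prop) _ _)
      (Continuous.intervalIntegrable (by fun_prop) _ _)]
    congr 1; funext u; ring
  have h2 : |∫ u in (0 : ℝ)..t, Real.exp (-(2 * θ) * (t - u)) * (laplaceRpow a θ u - J)|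
      ≤ Real.exp (-θ * (t / 2)) * E * ∫ u in (0 : ℝ)..t, Real.exp (-θ * (t - u)) := by
    rw [← intervalIntegral.integral_const_mul, ← Real.norm_eq_abs]
    refine intervalIntegral.norm_integral_le_of_norm_le ht (Filter.Eventually.of_forall ?_)
      (Continuous.intervalIntegrable (by fun_prop) _ _)
    intro u hu
    rw [Real.norm_eq_abs, abs_mul, abs_of_pos (Real.exp_pos _)]
    calc _ ≤ Real.exp (-(2 * θ) * (t - u)) * (Real.exp (-θ * (u / 2)) * E) := by
          gcongr; exact laplaceRpow_bounds ha hθ hu.1.le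
      _ = Real.exp (-(2 * θ) * (t - u) + -θ * (u / 2)) * E := by rw [Real.exp_add]; ring
      -- Part of the rate `2θ` is traded for uniform decay in `t`, leaving a kernel of mass at most
      -- `1 / θ`.
      _ ≤ Real.exp (-θ * (t / 2) + -θ * (t - u)) * E := by
        refine mul_le_mul_of_nonneg_right (Real.exp_le_exp.2 ?_) hE
        nlinarith [hu.2]
      _ = _ := by rw [Real.exp_add]; ring
  have h3 : ∫ u in (0 : ℝ)..t, Real.exp (-θ * (t - u)) ≤ 1 / θ := by
    rw [integral_expKernel hθ.ne']
    gcongr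
    linarith [Real.exp_pos (-θ * (t - 0))]
  have h4 : Real.exp (-(2 * θ) * t) ≤ Real.exp (-θ * (t / 2)) := by
    refine Real.exp_le_exp.2 ?_
    nlinarith
  rw [h1]
  set I := ∫ u in (0 : ℝ)..t, Real.exp (-(2 * θ) * (t - u)) * (laplaceRpow a θ u - J)
  calc _ = |I - Real.exp (-(2 * θ) * t) * (J / (2 * θ))| := by congr 1; ring
    _ ≤ |I| + |Real.exp (-(2 * θ) * t) * (J / (2 * θ))| := abs_sub _ _
    _ ≤ Real.exp (-θ * (t / 2)) * E * (1 / θ) + Real.exp (-θ * (t / 2)) * (J / θ) := by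
      rw [abs_of_nonneg (by positivity : 0 ≤ Real.exp (-(2 * θ) * t) * (J / (2 * θ)))]
      have h5 : J / (2 * θ) ≤ J / θ := by gcongr; linarith
      gcongr
      exact h2.trans (by gcongr)
    _ = _ := by ring

lemma abs_ouFilter_ouFilter_fBmCov_sub_le {a θ t : ℝ} (ha : 0 < a) (hθ : 0 < θ) (ht : 1 ≤ t) :
    |ouFilter θ t (fun x => ouFilter θ t (fBmCov a x)) - a / 2 * Real.Gamma a / θ ^ a|
      ≤ ((2 + θ * (Real.Gamma (a + 1) / θ ^ (a + 1))
        + 2 * θ * (Real.Gamma (a + 1) / (θ / 2) ^ (a + 1))) * (8 / θ ^ 2)) * t ^ (a - 2) := by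
  have ht0 : 0 < t := by linarith
  have hg : 0 < Real.Gamma (a + 1) := Real.Gamma_pos_of_pos (by linarith)
  -- With `J` the complete Laplace transform, the limit is `θ J - θ ^ 2 * J / (2 θ) = θ J / 2`.
  have hG : a / 2 * Real.Gamma a / θ ^ a = θ / 2 * (Real.Gamma (a + 1) / θ ^ (a + 1)) := by
    rw [Real.Gamma_add_one ha.ne', Real.rpow_add_one hθ.ne']
    field_simp
  have h1 := laplaceRpow_bounds ha hθ ht0.le
  have h2 := abs_integral_expKernel_mul_laplaceRpow_sub_le ha hθ ht0.le
  have h3 : |ouFilter θ t (fun r => |r| ^ a)| ≤ 2 * t ^ a := by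
    refine abs_ouFilter_le hθ ht0.le fun r hr => ?_
    rw [abs_of_nonneg hr.1, abs_of_nonneg (Real.rpow_nonneg hr.1 _)]
    exact Real.rpow_le_rpow hr.1 hr.2 ha.le
  have h4 := exp_neg_mul_half_le (a := a) hθ ht0
  have h5 := exp_neg_mul_half_le_rpow ha.le hθ ht
  have h6 : Real.exp (-θ * t) ≤ Real.exp (-θ * (t / 2)) := by
    refine Real.exp_le_exp.2 ?_
    nlinarith
  rw [ouFilter_ouFilter_fBmCov ha hθ ht0.le, hG]
  set J := Real.Gamma (a + 1) / θ ^ (a + 1)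
  set E := Real.Gamma (a + 1) / (θ / 2) ^ (a + 1)
  have hJ : 0 ≤ J := by positivity
  have hE : 0 ≤ E := by positivity
  set g := ouFilter θ t (fun r => |r| ^ a)
  set l := laplaceRpow a θ t
  set I := ∫ u in (0 : ℝ)..t, Real.exp (-(2 * θ) * (t - u)) * laplaceRpow a θ u
  set e := Real.exp (-θ * (t / 2))
  calc _ = |Real.exp (-θ * t) * g + θ * (l - J) - θ ^ 2 * (I - J / (2 * θ))| := by
        congr 1; field_simp; ring
    _ ≤ |Real.exp (-θ * t) * g| + |θ * (l - J)| + |θ ^ 2 * (I - J / (2 * θ))| :=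
        (abs_sub _ _).trans (by gcongr; exact abs_add_le _ _)
    _ ≤ e * (2 * t ^ a) + θ * (e * E) + θ ^ 2 * (e * ((J + E) / θ)) := by
      rw [abs_mul, abs_mul, abs_mul, abs_of_pos (Real.exp_pos _), abs_of_pos hθ,
        abs_of_pos (by positivity : 0 < θ ^ 2)]
      gcongr
    _ = 2 * (e * t ^ a) + (θ * J + 2 * θ * E) * e := by field_simp; ring
    _ ≤ 2 * (8 / θ ^ 2 * t ^ (a - 2)) + (θ * J + 2 * θ * E) * (8 / θ ^ 2 * t ^ (a - 2)) := by
      gcongr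
    _ = _ := by ring

/-! ### Limit variance and decay for the full kernel -/

/-- The stationary limit of the variance of the filtered process, with its rate. -/
lemma exists_abs_ouFilter_subfBmCov_sub_le {a θ : ℝ} (ha0 : 0 < a) (ha : a < 2) (hθ : 0 < θ) :
    ∃ C : ℝ, 0 ≤ C ∧ ∀ t : ℝ, 1 ≤ t →
      |ouFilter θ t (fun x => ouFilter θ t (subfBmCov a x)) - a / 2 * Real.Gamma a / θ ^ a|
        ≤ C * t ^ (a - 2) := by
  have hg : 0 < Real.Gamma (a + 1) := Real.Gamma_pos_of_pos (by linarith)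
  refine ⟨(2 + θ * (Real.Gamma (a + 1) / θ ^ (a + 1))
    + 2 * θ * (Real.Gamma (a + 1) / (θ / 2) ^ (a + 1))) * (8 / θ ^ 2)
    + ((1 / 2 : ℝ) ^ (a - 2) + 64 * 2 ^ a) / θ ^ 2, by positivity, fun t ht => ?_⟩
  have hB := continuous_fBmCov ha0
  have hT := continuous_reflectedCov ha0
  have e : ouFilter θ t (fun x => ouFilter θ t (subfBmCov a x))
      = ouFilter θ t (fun x => ouFilter θ t (fBmCov a x))
        + ouFilter θ t (fun x => ouFilter θ t (reflectedCov a x)) := by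
    rw [← ouFilter_add θ t (continuous_ouFilter_right θ t hB)
      (continuous_ouFilter_right θ t hT)]
    congr 1; funext x
    rw [← ouFilter_add θ t (continuous_section hB x) (continuous_section hT x)]
    congr 1; funext y
    exact subfBmCov_eq a x y
  rw [e, add_sub_right_comm]
  refine (abs_add_le _ _).trans ((add_le_add (abs_ouFilter_ouFilter_fBmCov_sub_le ha0 hθ ht)
    (abs_ouFilter_ouFilter_reflectedCov_le ha0 ha hθ (by linarith))).trans_eq
    (add_mul _ _ _).symm)

lemma abs_ouFilter_subfBmCov_le {a θ t s m : ℝ} (ha0 : 0 < a) (hθ : 0 < θ) (ht : t ∈ Set.Icc 0 m)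
    (hs : s ∈ Set.Icc 0 m) :
    |ouFilter θ t (fun x => ouFilter θ s (subfBmCov a x))| ≤ 12 * (2 * m) ^ a := by
  have : |ouFilter θ t (fun x => ouFilter θ s (subfBmCov a x))|
      ≤ 2 * (2 * (3 * (2 * m) ^ a)) := by
    refine abs_ouFilter_le hθ ht.1 fun x hx => abs_ouFilter_le hθ hs.1 fun y hy => ?_
    exact abs_subfBmCov_le ha0 ⟨hx.1, hx.2.trans ht.2⟩ ⟨hy.1, hy.2.trans hs.2⟩
  linarith

/-- Decay of the covariance, in terms of the covariance at the midpoint. -/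
lemma abs_ouFilter_subfBmCov_sub_midpoint_le {a θ t s : ℝ} (ha0 : 0 < a) (ha : a < 2)
    (hθ : 0 < θ) (hs : 0 ≤ s) (hst : s < t) :
    |ouFilter θ t (fun x => ouFilter θ s (subfBmCov a x)) - Real.exp (-θ * ((t - s) / 2))
        * ouFilter θ ((t + s) / 2) (fun x => ouFilter θ s (subfBmCov a x))|
      ≤ 2 * (1 / 2) ^ (a - 2) / θ ^ 2 * (t - s) ^ (a - 2) := by
  have hd : 0 < (t - s) / 2 := by linarith
  have h := abs_ouFilter_ouFilter_sub_le (θ := θ) (p := (t + s) / 2) (t := t) (s := s)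
    (c := 2 * ((t - s) / 2) ^ (a - 2)) hθ (by linarith) hs (continuous_subfBmCov ha0)
    (by positivity) (fun x _ => subfBmCov_zero_right ha0 x)
    (fun x hx u hu => abs_subfBmCov_rect_le ha0 ha hd hs (by linarith) hx hu)
  rw [show t - (t + s) / 2 = (t - s) / 2 by ring] at h
  refine h.trans_eq ?_
  rw [div_eq_mul_one_div (t - s) 2, Real.mul_rpow (by linarith) (by norm_num)]
  ring

/-! ### Variation of constants -/

/-- Variation of constants for the Langevin equation driven by a path. -/
lemma eq_ouFilter_of_langevin {θ : ℝ} {x s : ℝ≥0 → ℝ} (hx : Continuous x)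
    (heq : ∀ t : ℝ≥0, x t = -θ * (∫ r in (0 : ℝ)..t, x r.toNNReal) + s t) :
    Continuous s ∧ ∀ t : ℝ≥0, x t = ouFilter θ t fun r => s r.toNNReal := by
  have hy : Continuous fun r : ℝ => x r.toNNReal := hx.comp continuous_real_toNNReal
  set I : ℝ → ℝ := fun t => ∫ r in (0 : ℝ)..t, x r.toNNReal
  have hI : ∀ t, HasDerivAt I (x t.toNNReal) t := fun t =>
    (hy.integral_hasStrictDerivAt 0 t).hasDerivAt
  have hIc : Continuous I := continuous_iff_continuousAt.2 fun t => (hI t).continuousAt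
  have hs : ∀ t : ℝ≥0, s t = x t + θ * I t := fun t => by rw [heq t]; ring
  refine ⟨?_, fun t => ?_⟩
  · rw [funext hs]
    exact hx.add (continuous_const.mul (hIc.comp NNReal.continuous_coe))
  · have h1 : ∫ r in (0 : ℝ)..t, Real.exp (-θ * (t - r)) * s r.toNNReal
        = ∫ r in (0 : ℝ)..t, Real.exp (-θ * (t - r)) * (x r.toNNReal + θ * I r) := by
      refine intervalIntegral.integral_congr fun r hr => ?_
      rw [Set.uIcc_of_le t.coe_nonneg] at hr
      simp only [hs, Real.coe_toNNReal r hr.1]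
    -- Since `s = x + θ I` with `I' = x`, the integrand is the derivative of `exp (-θ (t - r)) * I
    -- r`.
    have h2 : ∫ r in (0 : ℝ)..t, Real.exp (-θ * (t - r)) * (x r.toNNReal + θ * I r)
        = Real.exp (-θ * (t - t)) * I t - Real.exp (-θ * (t - 0)) * I 0 := by
      refine intervalIntegral.integral_eq_sub_of_hasDerivAt
        (f := fun r => Real.exp (-θ * (t - r)) * I r) (fun r _ => ?_)
        (Continuous.intervalIntegrable (by fun_prop) _ _)
      have := ((((hasDerivAt_id r).const_sub (t : ℝ)).const_mul (-θ)).exp).mul (hI r)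
      refine this.congr_deriv ?_
      simp only [id]; ring
    have h3 : I 0 = 0 := intervalIntegral.integral_same
    rw [ouFilter, h1, h2, h3, Real.toNNReal_coe, hs]
    simp

/-! ### Joint measurability and Fubini for square-integrable processes -/

section

variable {Ω : Type*} [MeasurableSpace Ω] {P : Measure Ω}

/-- A process with almost surely continuous paths is jointly measurable up to null sets. -/
lemma aestronglyMeasurable_uncurry_of_ae_continuous [SFinite P] {S : ℝ≥0 → Ω → ℝ}
    (hS : ∀ t, AEMeasurable (S t) P) (hc : ∀ᵐ ω ∂P, Continuous fun t => S t ω)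
    (μ : Measure ℝ) [SFinite μ] :
    AEStronglyMeasurable (fun p : Ω × ℝ => S p.2.toNNReal p.1) (P.prod μ) := by
  have hfloor : ∀ n : ℕ, Measurable fun r : ℝ => ⌊(r.toNNReal : ℝ) * n⌋₊ := fun n =>
    Nat.measurable_floor.comp (by fun_prop)
  -- Sampling the path at the grid points `k / n` uses countably many times, so measurable versions
  -- can be chosen simultaneously; continuity gives convergence.
  refine aestronglyMeasurable_of_tendsto_ae Filter.atTop
    (f := fun (n : ℕ) (p : Ω × ℝ) =>
      S (((⌊(p.2.toNNReal : ℝ) * n⌋₊ : ℝ) / n).toNNReal) p.1) (fun n => ?_) ?_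
  · have hm : Measurable fun q : ℕ × Ω => (hS ((q.1 : ℝ) / n).toNNReal).mk _ q.2 :=
      measurable_from_prod_countable_right fun k => (hS ((k : ℝ) / n).toNNReal).measurable_mk
    have hm' : Measurable fun p : Ω × ℝ => (⌊(p.2.toNNReal : ℝ) * n⌋₊, p.1) :=
      ((hfloor n).comp measurable_snd).prodMk measurable_fst
    refine ⟨_, (hm.comp hm').stronglyMeasurable, ?_⟩
    have : ∀ᵐ ω ∂P, ∀ k : ℕ, S ((k : ℝ) / n).toNNReal ω
        = (hS ((k : ℝ) / n).toNNReal).mk _ ω :=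
      ae_all_iff.2 fun k => (hS ((k : ℝ) / n).toNNReal).ae_eq_mk
    filter_upwards [Measure.quasiMeasurePreserving_fst.ae this] with p hp
    exact hp _
  · filter_upwards [Measure.quasiMeasurePreserving_fst.ae hc] with p hp
    have h1 := (tendsto_nat_floor_mul_div_atTop (R := ℝ) (a := p.2.toNNReal)
      p.2.toNNReal.2).comp tendsto_natCast_atTop_atTop
    have h2 := (hp.comp continuous_real_toNNReal).continuousAt.tendsto.comp h1
    simp only [Function.comp_def, Real.toNNReal_coe] at h2
    exact h2

lemma sq_integral_le {α : Type*} [MeasurableSpace α] {μ : Measure α} [IsFiniteMeasure μ]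
    {g : α → ℝ} (hg : MemLp g 2 μ) :
    (∫ x, g x ∂μ) ^ 2 ≤ μ.real Set.univ * ∫ x, g x ^ 2 ∂μ := by
  have h1 : Integrable g μ := hg.integrable (by norm_num)
  have h2 : Integrable (fun x => g x ^ 2) μ := hg.integrable_sq
  set m := μ.real Set.univ
  set I := ∫ x, g x ∂μ
  set J := ∫ x, g x ^ 2 ∂μ
  have hm : 0 ≤ m := measureReal_nonneg
  have key : ∀ c : ℝ, 0 ≤ J - 2 * c * I + m * c ^ 2 := fun c => by
    have e : ∫ x, (g x - c) ^ 2 ∂μ = J - 2 * c * I + m * c ^ 2 := by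
      have : ∀ x, (g x - c) ^ 2 = g x ^ 2 - 2 * c * g x + c ^ 2 := fun x => by ring
      simp only [this]
      rw [integral_add (f := fun x => g x ^ 2 - 2 * c * g x) (h2.sub (h1.const_mul _))
        (integrable_const _), integral_sub h2 (h1.const_mul _), integral_const_mul,
        integral_const]
      rfl
    rw [← e]
    exact integral_nonneg fun x => sq_nonneg _
  rcases hm.eq_or_lt with h | h
  · rw [← h]
    have hμ : μ = 0 := by
      have h' : μ.real Set.univ = 0 := h.symm
      rwa [measureReal_eq_zero_iff, Measure.measure_univ_eq_zero] at h'
    simp [I, hμ]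
  -- `I / m` is the mean of `g`, the minimiser of the quadratic in `c`.
  · have := key (I / m)
    have e : J - 2 * (I / m) * I + m * (I / m) ^ 2 = (m * J - I ^ 2) / m := by
      field_simp; ring
    rw [e] at this
    have := (div_nonneg_iff.1 this).resolve_right (fun h' => by linarith [h'.2])
    linarith [this.1]

lemma memLp_two_uncurry [IsFiniteMeasure P] {μ : Measure ℝ} [IsFiniteMeasure μ]
    {g : Ω → ℝ → ℝ} {M : ℝ} (hm : AEStronglyMeasurable (Function.uncurry g) (P.prod μ))
    (hg : ∀ᵐ r ∂μ, MemLp (fun ω => g ω r) 2 P) (hM : ∀ᵐ r ∂μ, ∫ ω, g ω r ^ 2 ∂P ≤ M) :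
    MemLp (Function.uncurry g) 2 (P.prod μ) := by
  have hm2 : AEStronglyMeasurable (fun p : Ω × ℝ => g p.1 p.2 ^ 2) (P.prod μ) := hm.pow 2
  rw [memLp_two_iff_integrable_sq hm]
  refine (integrable_prod_iff' hm2).2 ⟨hg.mono fun r hr => hr.integrable_sq, ?_⟩
  refine Integrable.mono' (integrable_const M) hm2.norm.prod_swap.integral_prod_right' ?_
  filter_upwards [hM] with r hr
  rw [Real.norm_eq_abs, abs_of_nonneg (integral_nonneg fun _ => norm_nonneg _)]
  simpa using hr

lemma memLp_two_integral [IsFiniteMeasure P] {μ : Measure ℝ} [IsFiniteMeasure μ]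
    {g : Ω → ℝ → ℝ} (hg : MemLp (Function.uncurry g) 2 (P.prod μ)) :
    MemLp (fun ω => ∫ r, g ω r ∂μ) 2 P := by
  have hm : AEStronglyMeasurable (fun ω => ∫ r, g ω r ∂μ) P := hg.1.integral_prod_right'
  have hi : Integrable (fun p : Ω × ℝ => g p.1 p.2 ^ 2) (P.prod μ) := hg.integrable_sq
  rw [memLp_two_iff_integrable_sq hm]
  refine Integrable.mono' (hi.integral_prod_left.const_mul (μ.real Set.univ)) (hm.pow 2) ?_
  filter_upwards [hi.prod_right_ae, hg.1.prodMk_left] with ω h1 h2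
  rw [Real.norm_eq_abs, abs_of_nonneg (sq_nonneg _)]
  exact sq_integral_le ((memLp_two_iff_integrable_sq h2).2 h1)

lemma integral_mul_integral_swap [IsFiniteMeasure P] {μ : Measure ℝ} [IsFiniteMeasure μ]
    {g : Ω → ℝ → ℝ} (hg : MemLp (Function.uncurry g) 2 (P.prod μ)) {Z : Ω → ℝ}
    (hZ : MemLp Z 2 P) :
    ∫ ω, Z ω * ∫ r, g ω r ∂μ ∂P = ∫ r, ∫ ω, Z ω * g ω r ∂P ∂μ := by
  have h : Integrable (fun p : Ω × ℝ => Z p.1 * g p.1 p.2) (P.prod μ) :=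
    (hZ.comp_fst μ).integrable_mul hg
  simp only [← integral_const_mul]
  exact integral_integral_swap h

end

/-! ### Non-stationarity of the increments -/

/-- Non-stationarity of the increments comes down to the strict convexity of
`b ↦ 3 ^ (-b) + (4 / 3) ^ b / 2`, which takes the value `1` at `1` and `2`. -/
lemma three_rpow_ne {a : ℝ} (ha : a < 2) (ha1 : a ≠ 1) :
    (3 : ℝ) ^ a ≠ 1 + 1 / 2 * 4 ^ a := by
  intro h
  set F : ℝ → ℝ := fun b => (3 : ℝ) ^ (-b) + 1 / 2 * (4 / 3) ^ b with hF
  have hlin : ∀ c : ℝ, c ≠ 0 → StrictConvexOn ℝ Set.univ fun b : ℝ => Real.exp (c * b) := by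
    intro c hc
    refine ⟨convex_univ, fun x _ y _ hxy u v hu hv huv => ?_⟩
    have := strictConvexOn_exp.2 (Set.mem_univ (c * x)) (Set.mem_univ (c * y))
      (fun e => hxy (mul_left_cancel₀ hc e)) hu hv huv
    simp only [smul_eq_mul] at this ⊢
    convert this using 2
    ring
  have hFc : StrictConvexOn ℝ Set.univ F := by
    have h1 := hlin (-Real.log 3) (neg_ne_zero.2 (Real.log_pos (by norm_num)).ne')
    have h2 := (hlin (Real.log (4 / 3)) (Real.log_pos (by norm_num)).ne').convexOn.smul
      (by norm_num : (0 : ℝ) ≤ 1 / 2)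
    refine (h1.add_convexOn h2).congr fun b _ => ?_
    simp only [hF, Pi.add_apply, smul_eq_mul]
    rw [Real.rpow_def_of_pos (by norm_num), Real.rpow_def_of_pos (by norm_num)]
    ring_nf
  have hFa : F a = 1 := by
    simp only [hF]
    rw [Real.rpow_neg (by norm_num), Real.div_rpow (by norm_num) (by norm_num)]
    have : (0 : ℝ) < 3 ^ a := by positivity
    field_simp
    linarith
  have hF1 : F 1 = 1 := by simp only [hF]; rw [Real.rpow_neg (by norm_num)]; norm_num
  have hF2 : F 2 = 1 := by
    simp only [hF]; rw [Real.rpow_neg (by norm_num)]; norm_num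
  rcases lt_or_gt_of_ne ha1 with h1 | h1
  -- A strictly convex function cannot take one value at the three points `a`, `1`, `2`; the middle
  -- one is `1` here and `a` in the other case.
  · have := hFc.lt_on_openSegment (Set.mem_univ a) (Set.mem_univ 2) ha.ne
      (z := 1) (by rw [openSegment_eq_Ioo ha]; exact ⟨h1, by norm_num⟩)
    simp [hFa, hF1, hF2] at this
  · have := hFc.lt_on_openSegment (Set.mem_univ 1) (Set.mem_univ 2) (by norm_num)
      (z := a) (by rw [openSegment_eq_Ioo (by norm_num)]; exact ⟨h1, ha⟩)
    simp [hFa, hF1, hF2] at this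

/-! ### Second moments of the driving process and of the solution -/

section

variable {Ω : Type*} [MeasurableSpace Ω] {P : Measure Ω}

namespace IsSubfBm

variable {H θ : ℝ} {S X : ℝ≥0 → Ω → ℝ}

lemma memLp_two [IsProbabilityMeasure P] (hS : IsSubfBm P H S) (t : ℝ≥0) : MemLp (S t) 2 P :=
  (hS.gaussian.hasGaussianLaw_eval t).memLp_two

lemma integral_mul (hS : IsSubfBm P H S) {x y : ℝ} (hx : 0 ≤ x) (hy : 0 ≤ y) :
    ∫ ω, S x.toNNReal ω * S y.toNNReal ω ∂P = subfBmCov (2 * H) x y := by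
  rw [hS.covariance, Real.coe_toNNReal x hx, Real.coe_toNNReal y hy, subfBmCov,
    abs_of_nonneg hx, abs_of_nonneg hy, abs_of_nonneg (add_nonneg hx hy)]

lemma integral_sub_sq [IsProbabilityMeasure P] (hS : IsSubfBm P H S) {x y : ℝ} (hx : 0 ≤ x)
    (hy : 0 ≤ y) : ∫ ω, (S x.toNNReal ω - S y.toNNReal ω) ^ 2 ∂P
      = subfBmCov (2 * H) x x - 2 * subfBmCov (2 * H) x y + subfBmCov (2 * H) y y := by
  rw [← hS.integral_mul hx hx, ← hS.integral_mul hx hy, ← hS.integral_mul hy hy]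
  have hX := hS.memLp_two x.toNNReal
  have hY := hS.memLp_two y.toNNReal
  have h1 : Integrable (fun ω => S x.toNNReal ω * S x.toNNReal ω) P := hX.integrable_mul hX
  have h2 : Integrable (fun ω => S x.toNNReal ω * S y.toNNReal ω) P := hX.integrable_mul hY
  have h3 : Integrable (fun ω => S y.toNNReal ω * S y.toNNReal ω) P := hY.integrable_mul hY
  rw [← integral_const_mul, ← integral_sub h1 (h2.const_mul 2),
    ← integral_add (f := fun ω => S x.toNNReal ω * S x.toNNReal ω
      - 2 * (S x.toNNReal ω * S y.toNNReal ω)) (h1.sub (h2.const_mul 2)) h3]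
  congr 1; funext ω; ring

/-- Equal variances of the increments over `[1, 2]` and `[0, 1]` would force `3 ^ (2H) = 1 + 4 ^
(2H) / 2`. -/
lemma not_hasStationaryIncrements [IsProbabilityMeasure P] (hS : IsSubfBm P H S) (hH0 : 0 < H)
    (hH1 : H < 1) (hH : H ≠ 1 / 2) : ¬ HasStationaryIncrements P S := by
  intro h
  have h1 := ((h 1 {1}).comp (measurable_pi_apply ⟨1, Finset.mem_singleton_self 1⟩)).comp
    (measurable_id.pow_const 2) |>.integral_eq
  have h2 := hS.integral_sub_sq (x := 2) (y := 1) (by norm_num) (by norm_num)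
  have h3 := hS.integral_sub_sq (x := 1) (y := 0) (by norm_num) le_rfl
  have e2 : (2 : ℝ).toNNReal = 1 + 1 := by
    rw [← NNReal.coe_inj, Real.coe_toNNReal _ (by norm_num)]; norm_num
  rw [Real.toNNReal_one] at h2 h3
  rw [Real.toNNReal_zero] at h3
  rw [e2] at h2
  simp only [Function.comp_def, id] at h1
  have h4 := h2.symm.trans (h1.trans h3)
  rw [subfBmCov_zero_right (by linarith), subfBmCov_zero_right (by linarith)] at h4
  have h5 : (2 : ℝ) ^ (2 * H) * 2 ^ (2 * H) = 4 ^ (2 * H) := by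
    rw [← Real.mul_rpow (by norm_num) (by norm_num)]; norm_num
  have h6 : |(2 : ℝ) + 2| ^ (2 * H) = 4 ^ (2 * H) := by norm_num
  have h7 : |(2 : ℝ) + 1| ^ (2 * H) = 3 ^ (2 * H) := by norm_num
  have h8 : |(1 : ℝ) + 1| ^ (2 * H) = 2 ^ (2 * H) := by norm_num
  have h9 : |(2 : ℝ) - 1| ^ (2 * H) = 1 := by norm_num
  have h10 : (0 : ℝ) ^ (2 * H) = 0 := Real.zero_rpow (by linarith)
  simp only [subfBmCov, h6, h7, h8, h9, sub_self, abs_zero, h10, abs_one, Real.one_rpow,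
    abs_two] at h4
  exact three_rpow_ne (a := 2 * H) (by linarith)
    (fun e => hH (by linarith)) (by linarith)

lemma ae_langevin (hX : IsLangevinSolution P θ S X) :
    ∀ᵐ ω ∂P, Continuous (fun t => S t ω) ∧
      ∀ t : ℝ≥0, X t ω = ouFilter θ t fun r => S r.toNNReal ω := by
  filter_upwards [hX.continuous, hX.equation] with ω h1 h2
  exact eq_ouFilter_of_langevin h1 h2

lemma ae_eq_langevin (hX : IsLangevinSolution P θ S X) (t : ℝ≥0) :
    X t =ᵐ[P] fun ω => S t ω - θ * ∫ r in Set.Ioc 0 (t : ℝ),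
      Real.exp (-θ * (t - r)) * S r.toNNReal ω := by
  filter_upwards [ae_langevin hX] with ω h
  rw [h.2 t, ouFilter, Real.toNNReal_coe, intervalIntegral.integral_of_le t.coe_nonneg]

variable [IsProbabilityMeasure P]

lemma memLp_two_uncurry_expKernel (hS : IsSubfBm P H S) (hX : IsLangevinSolution P θ S X)
    (hH : 0 < H) (hθ : 0 < θ) (t : ℝ≥0) :
    MemLp (Function.uncurry fun ω (r : ℝ) => Real.exp (-θ * (t - r)) * S r.toNNReal ω) 2
      (P.prod (volume.restrict (Set.Ioc 0 (t : ℝ)))) := by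
  have hc : ∀ᵐ ω ∂P, Continuous fun t => S t ω := (ae_langevin hX).mono fun ω h => h.1
  have hm := aestronglyMeasurable_uncurry_of_ae_continuous
    (fun t => (hS.gaussian.aemeasurable t)) hc (volume.restrict (Set.Ioc 0 (t : ℝ)))
  have hk : Measurable fun p : Ω × ℝ => Real.exp (-θ * (t - p.2)) := by fun_prop
  refine memLp_two_uncurry (M := 3 * (2 * t) ^ (2 * H)) (hk.aestronglyMeasurable.mul hm)
    (Filter.Eventually.of_forall fun r => (hS.memLp_two _).const_mul _) ?_
  filter_upwards [ae_restrict_mem measurableSet_Ioc] with r hr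
  simp only [mul_pow]
  rw [integral_const_mul]
  have h1 := hS.integral_mul hr.1.le hr.1.le
  simp only [← pow_two] at h1
  have h2 := abs_subfBmCov_le (a := 2 * H) (by linarith) ⟨hr.1.le, hr.2⟩ ⟨hr.1.le, hr.2⟩
  have h3 : Real.exp (-θ * (t - r)) ≤ 1 := Real.exp_le_one_iff.2 (by nlinarith [hr.2])
  have h4 : Real.exp (-θ * (t - r)) ^ 2 ≤ 1 := pow_le_one₀ (Real.exp_pos _).le h3
  have h5 : 0 ≤ subfBmCov (2 * H) r r := by
    rw [← h1]; exact integral_nonneg fun _ => sq_nonneg _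
  rw [h1]
  exact (mul_le_of_le_one_left h5 h4).trans ((le_abs_self _).trans h2)

lemma memLp_two_langevin (hS : IsSubfBm P H S) (hX : IsLangevinSolution P θ S X)
    (hH : 0 < H) (hθ : 0 < θ) (t : ℝ≥0) : MemLp (X t) 2 P :=
  (memLp_congr_ae (ae_eq_langevin hX t)).2 ((hS.memLp_two t).sub
    ((memLp_two_integral (hS.memLp_two_uncurry_expKernel hX hH hθ t)).const_mul θ))

/-- Keeping `Z` arbitrary lets the identity be used twice for the covariance: with `Z = X s`, then
with `Z` a value of `S`. -/
lemma integral_mul_langevin (hS : IsSubfBm P H S) (hX : IsLangevinSolution P θ S X)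
    (hH : 0 < H) (hθ : 0 < θ) {Z : Ω → ℝ} (hZ : MemLp Z 2 P) (t : ℝ≥0) :
    ∫ ω, Z ω * X t ω ∂P = ouFilter θ t fun r => ∫ ω, Z ω * S r.toNNReal ω ∂P := by
  have hg := hS.memLp_two_uncurry_expKernel hX hH hθ t
  have hY := memLp_two_integral hg
  have h1 : ∫ ω, Z ω * X t ω ∂P = ∫ ω, (Z ω * S t ω - θ * (Z ω *
      ∫ r in Set.Ioc 0 (t : ℝ), Real.exp (-θ * (t - r)) * S r.toNNReal ω)) ∂P := by
    refine integral_congr_ae ?_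
    filter_upwards [ae_eq_langevin hX t] with ω h
    rw [h]; ring
  have i1 : Integrable (fun ω => Z ω * S t ω) P := hZ.integrable_mul (hS.memLp_two t)
  have i2 : Integrable (fun ω => Z ω *
      ∫ r in Set.Ioc 0 (t : ℝ), Real.exp (-θ * (t - r)) * S r.toNNReal ω) P :=
    hZ.integrable_mul hY
  rw [h1, integral_sub i1 (i2.const_mul θ), integral_const_mul, integral_mul_integral_swap hg hZ,
    ouFilter, Real.toNNReal_coe, intervalIntegral.integral_of_le t.coe_nonneg]
  simp only [mul_left_comm (Z _), integral_const_mul]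

/-- The covariance of the sub-fractional Ornstein–Uhlenbeck process. -/
lemma integral_langevin_mul_langevin (hS : IsSubfBm P H S) (hX : IsLangevinSolution P θ S X)
    (hH : 0 < H) (hθ : 0 < θ) (t s : ℝ≥0) :
    ∫ ω, X t ω * X s ω ∂P
      = ouFilter θ t fun x => ouFilter θ s (subfBmCov (2 * H) x) := by
  simp only [mul_comm (X t _)]
  rw [hS.integral_mul_langevin hX hH hθ (hS.memLp_two_langevin hX hH hθ s)]
  refine ouFilter_congr θ t.coe_nonneg fun x hx _ => ?_
  simp only [mul_comm (X s _)]
  rw [hS.integral_mul_langevin hX hH hθ (hS.memLp_two _)]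
  exact ouFilter_congr θ s.coe_nonneg fun y hy _ => hS.integral_mul hx hy

end IsSubfBm

end

/-! ### Assembly of the estimates -/

theorem theorem4p2 (H θ : ℝ) (hH0 : 0 < H) (hH1 : H < 1) (hH : H ≠ 1 / 2) (hθ : 0 < θ) :
    ∃ C : ℝ, 0 < C ∧
      ∀ (Ω : Type*) [MeasurableSpace Ω] (P : Measure Ω) [IsProbabilityMeasure P]
        (S X : ℝ≥0 → Ω → ℝ),
        IsSubfBm P H S → IsLangevinSolution P θ S X →
          ¬ HasStationaryIncrements P S ∧
          (∀ t : ℝ≥0, MemLp (X t) 2 P) ∧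
          (∀ t : ℝ≥0, 2 < t →
            |(∫ ω, X t ω ^ 2 ∂P) - H * Real.Gamma (2 * H) / θ ^ (2 * H)|
              ≤ C * (t : ℝ) ^ (2 * H - 2)) ∧
          (∀ t s : ℝ≥0, 2 < |(t : ℝ) - s| →
            ∫ ω, X t ω * X s ω ∂P ≤ C * |(t : ℝ) - s| ^ (2 * H - 2)) := by
  have ha0 : 0 < 2 * H := by linarith
  have ha : 2 * H < 2 := by linarith
  have hg : 0 < Real.Gamma (2 * H) := Real.Gamma_pos_of_pos ha0
  obtain ⟨C, hC0, hC⟩ := exists_abs_ouFilter_subfBmCov_sub_le ha0 ha hθ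
  rw [mul_div_cancel_left₀ H (two_ne_zero' ℝ)] at hC
  set L := H * Real.Gamma (2 * H) / θ ^ (2 * H)
  have hL : 0 < L := by positivity
  -- `M` bounds the variance at all times: `L + C` covers `t ≥ 1`, and the crude kernel bound with
  -- `m = 1` covers `t ≤ 1`.
  set M := L + C + 12 * (2 * 1) ^ (2 * H) with hM
  have hM0 : 0 < M := by positivity
  have hpos : ∀ (x : ℝ), 0 ≤ x → 0 ≤ x ^ (2 * H - 2) := fun x hx => Real.rpow_nonneg hx _
  refine ⟨C + (2 * (1 / 2) ^ (2 * H - 2) / θ ^ 2 + M * (8 / θ ^ 2)), by positivity, ?_⟩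
  intro Ω _ P _ S X hS hX
  have hcov := hS.integral_langevin_mul_langevin hX hH0 hθ
  have hmem := hS.memLp_two_langevin hX hH0 hθ
  have hvar : ∀ t : ℝ≥0, ∫ ω, X t ω ^ 2 ∂P ≤ M := by
    intro t
    simp only [pow_two, hcov]
    rcases le_total 1 (t : ℝ) with h | h
    · have h1 := (abs_le.1 (hC t h)).2
      have h2 : (t : ℝ) ^ (2 * H - 2) ≤ 1 := Real.rpow_le_one_of_one_le_of_nonpos h (by linarith)
      have h3 : (0 : ℝ) ≤ 12 * (2 * 1) ^ (2 * H) := by positivity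
      nlinarith
    · have h1 := (abs_le.1 (abs_ouFilter_subfBmCov_le (θ := θ) (t := t) (s := t) (m := 1) ha0 hθ
        ⟨t.coe_nonneg, h⟩ ⟨t.coe_nonneg, h⟩)).2
      linarith
  have hcovM : ∀ t s : ℝ≥0, ∫ ω, X t ω * X s ω ∂P ≤ M := by
    intro t s
    have i1 := (hmem t).integrable_sq
    have i2 := (hmem s).integrable_sq
    calc ∫ ω, X t ω * X s ω ∂P ≤ ∫ ω, (X t ω ^ 2 / 2 + X s ω ^ 2 / 2) ∂P := by
          refine integral_mono ((hmem t).integrable_mul (hmem s))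
            ((i1.div_const 2).add (i2.div_const 2)) fun ω => ?_
          have := sq_nonneg (X t ω - X s ω)
          change X t ω * X s ω ≤ _
          linarith
      _ = (∫ ω, X t ω ^ 2 ∂P) / 2 + (∫ ω, X s ω ^ 2 ∂P) / 2 := by
          rw [integral_add (i1.div_const 2) (i2.div_const 2), integral_div, integral_div]
      _ ≤ M := by linarith [hvar t, hvar s]
  have hdecay : ∀ t s : ℝ≥0, 2 < (t : ℝ) - s → ∫ ω, X t ω * X s ω ∂P
      ≤ (C + (2 * (1 / 2) ^ (2 * H - 2) / θ ^ 2 + M * (8 / θ ^ 2)))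
        * ((t : ℝ) - s) ^ (2 * H - 2) := by
    intro t s hts
    have h1 := (abs_le.1 (abs_ouFilter_subfBmCov_sub_midpoint_le (θ := θ) (t := t) (s := s)
      ha0 ha hθ s.coe_nonneg (by linarith))).2
    -- The midpoint covariance need only be bounded, since its damping factor is already of the
    -- required order.
    have h2 := hcovM ((t + s) / 2) s
    have h3 := exp_neg_mul_half_le_rpow (a := 2 * H) ha0.le hθ (by linarith : 1 ≤ (t : ℝ) - s)
    rw [hcov] at h2 ⊢
    push_cast at h2
    have h4 : Real.exp (-θ * (((t : ℝ) - s) / 2)) * ouFilter θ (((t : ℝ) + s) / 2)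
        (fun x => ouFilter θ s (subfBmCov (2 * H) x))
        ≤ 8 / θ ^ 2 * ((t : ℝ) - s) ^ (2 * H - 2) * M :=
      (mul_le_mul_of_nonneg_left h2 (Real.exp_pos _).le).trans
        (mul_le_mul_of_nonneg_right h3 hM0.le)
    have h5 : 0 ≤ C * ((t : ℝ) - s) ^ (2 * H - 2) := mul_nonneg hC0 (hpos _ (by linarith))
    linarith
  refine ⟨hS.not_hasStationaryIncrements hH0 hH1 hH, hmem, fun t ht => ?_, fun t s hts => ?_⟩
  · simp only [pow_two, hcov]
    have ht' : (2 : ℝ) < t := by exact_mod_cast ht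
    refine (hC t (by linarith)).trans
      (mul_le_mul_of_nonneg_right (le_add_of_nonneg_right ?_) (hpos _ t.coe_nonneg))
    positivity
  · rcases le_total (s : ℝ) t with h | h
    · rw [abs_of_nonneg (sub_nonneg.2 h)] at hts ⊢
      exact hdecay t s hts
    · rw [abs_sub_comm, abs_of_nonneg (sub_nonneg.2 h)] at hts ⊢
      simp only [mul_comm (X t _)]
      exact hdecay s t hts
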